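/- Let $\mathbb{N}=\{1,2,\dots\}$, let $S_\infty$ be the group of permutations of $\mathbb{N}$ with finite support, let $s_k$ be the transposition of $k$ and $k+1$, and let $\ell(w)$ be the minimal length of a word $(a_1,\dots,a_r)$ with $w=s_{a_1}\cdots s_{a_r}$. Let $H$ be the Demazure ($0$-Hecke) algebra over $\mathbb{Z}$, with generators $e_i$ ($i\in\mathbb{N}$) and relations $e_i^2=e_i$, $e_ie_j=e_je_i$ for $|i-j|>1$, $e_ie_{i+1}e_i=e_{i+1}e_ie_{i+1}$. Identify $w\in S_\infty$ with the basis element $e_{a_1}\cdots e_{a_\ell}$ of $H$, where $(a_1,\dots,a_\ell)$ is any reduced word of $w$, and write $u*v$ for the product in $H$. A pipe dream is a finite set $P\subseteq\{(i,j)\in\mathbb{Z}^2 : i+j-1\ge 1\}$; it is stable if $i\ge 1$ for all $(i,j)\in P$. Reading the numbers $i+j-1$ for $(i,j)\in P$ row by row with $i$ increasing, and within each row with $j$ decreasing, gives a word $(a_1,\dots,a_p)$, and the permutation of $P$ is the $w\in S_\infty$ identified with $e_{a_1}\cdots e_{a_p}\in H$. The $K$-Stanley symmetric function of $w$ is the formal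 power series over $\mathbb{Z}[\beta]$ $$G_w^{(\beta)}(x)=\sum_{P}\beta^{|P|-\ell(w)}\prod_{(i,j)\in P}x_i,$$ summed over all stable pipe dreams $P$ with permutation $w$. Proposition. For every $w\in S_\infty$, $$\sum_{w=s_k*v}\beta^{\delta_{w,v}}\,G_v^{(\beta)}(x)=\sum_{w=u*s_k}\beta^{\delta_{w,u}}\,G_u^{(\beta)}(x),$$ where the (finite) left sum runs over all pairs $(k,v)\in\mathbb{N}\times S_\infty$ with $w=s_k*v$, the (finite) right sum over all pairs $(k,u)\in\mathbb{N}\times S_\infty$ with $w=u*s_k$, and $\delta_{w,v}$ is $1$ if $w=v$ and $0$ otherwise. -/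

import Mathlib

namespace PipeDream

/-- `S_∞`: the group of permutations of `{1, 2, 3, …}` with finite support. -/
def SInf : Subgroup (Equiv.Perm ℕ+) where
  carrier := {w | {i | w i ≠ i}.Finite}
  one_mem' := by simp
  mul_mem' := by
    intro a b ha hb
    refine (Set.Finite.union ha hb).subset fun i hi => ?_
    by_contra h
    simp only [Set.mem_union, Set.mem_ofPred_eq, not_or, not_not] at h
    exact hi (by rw [Equiv.Perm.mul_apply, h.2, h.1])
  inv_mem' := by
    intro a ha
    refine Set.Finite.subset ha fun i hi h => hi ?_
    rw [Equiv.Perm.inv_eq_iff_eq]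
    exact h.symm

/-- The simple transposition `s_k`, which swaps `k` and `k + 1`. -/
def simple (k : ℕ+) : SInf :=
  ⟨Equiv.swap k (k + 1), ((Set.finite_singleton (k + 1)).insert k).subset fun i hi => by
    by_contra h
    simp only [Set.mem_insert_iff, Set.mem_singleton_iff, not_or] at h
    exact hi (Equiv.swap_apply_of_ne_of_ne h.1 h.2)⟩

/-- `a = (a₁, …, a_r)` is a word for `w`: `w = s_{a₁} ⋯ s_{a_r}`. -/
def IsWord (a : List ℕ+) (w : SInf) : Prop := (a.map simple).prod = w

/-- The length `ℓ(w)`: the minimal length of a word for `w`. -/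
noncomputable def len (w : SInf) : ℕ := sInf {r | ∃ a, IsWord a w ∧ a.length = r}

/-- A reduced word for `w`: a word of minimal length. -/
def IsReducedWord (a : List ℕ+) (w : SInf) : Prop := IsWord a w ∧ a.length = len w

theorem exists_isWord (w : SInf) : ∃ a, IsWord a w := by
  set S : Set (Equiv.Perm ℕ+) := Set.range fun k => (simple k : Equiv.Perm ℕ+) with hS
  have hsw : ∀ f ∈ S, f.IsSwap := by
    rintro _ ⟨k, rfl⟩
    exact ⟨k, k + 1, (PNat.lt_add_right k 1).ne, rfl⟩
  have horb : ∀ x : ℕ+, x ∈ MulAction.orbit (Subgroup.closure S) (1 : ℕ+) := by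
    intro x
    induction x using PNat.recOn with
    | one => exact MulAction.mem_orbit_self _
    | succ k ih =>
      have hk : (simple k : Equiv.Perm ℕ+) ∈ Subgroup.closure S :=
        Subgroup.subset_closure ⟨k, rfl⟩
      have := MulAction.mem_orbit_of_mem_orbit
        (⟨(simple k : Equiv.Perm ℕ+), hk⟩ : Subgroup.closure S) ih
      have h2 : ((⟨(simple k : Equiv.Perm ℕ+), hk⟩ : Subgroup.closure S) • k : ℕ+) = k + 1 :=
        Equiv.swap_apply_left k (k + 1)
      rwa [h2] at this
  have hw : (w : Equiv.Perm ℕ+) ∈ Subgroup.closure S := by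
    rw [mem_closure_isSwap hsw]
    refine ⟨?_, fun x => ?_⟩
    · exact w.2
    · rw [MulAction.orbit_eq_iff.mpr (horb x)]
      exact horb _
  suffices h : ∀ g ∈ Subgroup.closure S,
      ∃ a : List ℕ+, (a.map fun k => (simple k : Equiv.Perm ℕ+)).prod = g by
    obtain ⟨a, ha⟩ := h _ hw
    refine ⟨a, Subtype.ext ?_⟩
    rw [← ha, ← Subgroup.coe_subtype, map_list_prod, List.map_map]
    rfl
  intro g hg
  induction hg using Subgroup.closure_induction with
  | mem x hx =>
    obtain ⟨k, rfl⟩ := hx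
    exact ⟨[k], by simp⟩
  | one => exact ⟨[], rfl⟩
  | mul x y _ _ hx hy =>
    obtain ⟨a, rfl⟩ := hx
    obtain ⟨b, rfl⟩ := hy
    exact ⟨a ++ b, by simp⟩
  | inv x _ hx =>
    obtain ⟨a, rfl⟩ := hx
    refine ⟨a.reverse, ?_⟩
    rw [List.prod_inv_reverse, List.map_reverse, List.map_map]
    rfl

theorem exists_isReducedWord (w : SInf) : ∃ a, IsReducedWord a w := by
  obtain ⟨a, ha⟩ := exists_isWord w
  obtain ⟨b, hb, hl⟩ := Nat.sInf_mem (s := {r | ∃ a, IsWord a w ∧ a.length = r}) ⟨_, a, ha, rfl⟩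
  exact ⟨b, hb, hl⟩

/-- The defining relations of the Demazure (0-Hecke) algebra. -/
inductive DemazureRel : FreeAlgebra ℤ ℕ+ → FreeAlgebra ℤ ℕ+ → Prop
  | idem (i : ℕ+) : DemazureRel (.ι ℤ i * .ι ℤ i) (.ι ℤ i)
  | comm (i j : ℕ+) (h : i + 1 < j ∨ j + 1 < i) :
      DemazureRel (.ι ℤ i * .ι ℤ j) (.ι ℤ j * .ι ℤ i)
  | braid (i : ℕ+) :
      DemazureRel (.ι ℤ i * .ι ℤ (i + 1) * .ι ℤ i) (.ι ℤ (i + 1) * .ι ℤ i * .ι ℤ (i + 1))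

/-- The Demazure algebra `H`. -/
abbrev Demazure : Type := RingQuot DemazureRel

/-- The generator `e_i` of `H`. -/
noncomputable def gen (i : ℕ+) : Demazure := RingQuot.mkAlgHom ℤ DemazureRel (.ι ℤ i)

/-- `∂(a) = e_{a₁} ⋯ e_{a_r}` in `H`, for any word `a` (reduced or not). -/
noncomputable def wordElt (a : List ℕ+) : Demazure := (a.map gen).prod

theorem simple_mul_self (k : ℕ+) : simple k * simple k = 1 :=
  Subtype.ext (Equiv.swap_mul_self k (k + 1))

theorem simple_coe_inv (k : ℕ+) : ((simple k : SInf) : Equiv.Perm ℕ+)⁻¹ = Equiv.swap k (k + 1) :=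
  Equiv.swap_inv k (k + 1)

theorem simple_comm (i j : ℕ+) (h : i + 1 < j) :
    simple i * simple j = simple j * simple i := by
  refine Subtype.ext (Equiv.Perm.Disjoint.commute ?_)
  intro x
  by_cases hx : x = i ∨ x = i + 1
  · right
    have h1 : x < j := by
      rcases hx with rfl | rfl
      · exact (PNat.lt_add_right _ 1).trans h
      · exact h
    exact Equiv.swap_apply_of_ne_of_ne h1.ne (h1.trans (PNat.lt_add_right j 1)).ne
  · left
    push Not at hx
    exact Equiv.swap_apply_of_ne_of_ne hx.1 hx.2

theorem simple_braid (i : ℕ+) :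
    simple i * simple (i + 1) * simple i = simple (i + 1) * simple i * simple (i + 1) := by
  refine Subtype.ext ?_
  have h1 : i ≠ i + 1 := (PNat.lt_add_right i 1).ne
  have h2 : i + 1 ≠ i + 1 + 1 := (PNat.lt_add_right _ 1).ne
  have h3 : i ≠ i + 1 + 1 := ((PNat.lt_add_right i 1).trans (PNat.lt_add_right _ 1)).ne
  change Equiv.swap i (i+1) * Equiv.swap (i+1) (i+1+1) * Equiv.swap i (i+1) =
    Equiv.swap (i+1) (i+1+1) * Equiv.swap i (i+1) * Equiv.swap (i+1) (i+1+1)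
  ext x : 1
  simp only [Equiv.Perm.mul_apply, Equiv.swap_apply_def]
  grind

/-- The position `w⁻¹(k)` of the value `k` in the one-line notation of `w`. -/
def pos (w : SInf) (k : ℕ+) : ℕ+ := (w : Equiv.Perm ℕ+)⁻¹ k

theorem pos_injective (w : SInf) : Function.Injective (pos w) := Equiv.injective _

theorem pos_simple_mul (k j : ℕ+) (w : SInf) :
    pos (simple k * w) j = pos w (Equiv.swap k (k + 1) j) := by
  unfold pos
  rw [Subgroup.coe_mul, mul_inv_rev, simple_coe_inv]; rfl

/-- The action of `e_k` on `S_∞`: multiply by `s_k` on the left if that increases the length. -/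
noncomputable def demL (k : ℕ+) (w : SInf) : SInf :=
  if pos w k < pos w (k + 1) then simple k * w else w

theorem demL_idem (k : ℕ+) (w : SInf) : demL k (demL k w) = demL k w := by
  unfold demL
  split_ifs with h1 h2 <;> simp_all [pos_simple_mul]
  exact absurd h1 (not_lt.mpr h2.le)

theorem demL_comm (i j : ℕ+) (h : i + 1 < j) (w : SInf) :
    demL i (demL j w) = demL j (demL i w) := by
  have a1 : i < i + 1 := PNat.lt_add_right i 1
  have a2 : j < j + 1 := PNat.lt_add_right j 1
  have e1 : Equiv.swap j (j + 1) i = i :=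
    Equiv.swap_apply_of_ne_of_ne (a1.trans h).ne ((a1.trans h).trans a2).ne
  have e2 : Equiv.swap j (j + 1) (i + 1) = i + 1 :=
    Equiv.swap_apply_of_ne_of_ne h.ne (h.trans a2).ne
  have e3 : Equiv.swap i (i + 1) j = j :=
    Equiv.swap_apply_of_ne_of_ne (a1.trans h).ne' h.ne'
  have e4 : Equiv.swap i (i + 1) (j + 1) = j + 1 :=
    Equiv.swap_apply_of_ne_of_ne ((a1.trans h).trans a2).ne' (h.trans a2).ne'
  unfold demL
  have e5 : simple i * (simple j * w) = simple j * (simple i * w) := by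
    rw [← mul_assoc, simple_comm i j h, mul_assoc]
  split_ifs <;> (simp_all [pos_simple_mul]; try order)

theorem demL_braid (i : ℕ+) (w : SInf) :
    demL i (demL (i + 1) (demL i w)) = demL (i + 1) (demL i (demL (i + 1) w)) := by
  have a1 : i < i + 1 := PNat.lt_add_right i 1
  have a2 : i + 1 < i + 1 + 1 := PNat.lt_add_right _ 1
  have e1 : Equiv.swap i (i + 1) (i + 1 + 1) = i + 1 + 1 :=
    Equiv.swap_apply_of_ne_of_ne (a1.trans a2).ne' a2.ne'
  have e2 : Equiv.swap (i + 1) (i + 1 + 1) i = i :=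
    Equiv.swap_apply_of_ne_of_ne a1.ne (a1.trans a2).ne
  have hb := simple_braid i
  have hne1 : pos w i ≠ pos w (i + 1) := fun h =>
    a1.ne (pos_injective w h)
  have hne2 : pos w (i + 1) ≠ pos w (i + 1 + 1) := fun h =>
    a2.ne (pos_injective w h)
  have hne3 : pos w i ≠ pos w (i + 1 + 1) := fun h =>
    (a1.trans a2).ne (pos_injective w h)
  have hb' : simple i * (simple (i + 1) * (simple i * w)) =
      simple (i + 1) * (simple i * (simple (i + 1) * w)) := by
    simp only [← mul_assoc, hb]
  have key : ∀ k, demL k = fun v : SInf => if pos v k <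
    pos v (k + 1) then simple k * v else v := fun k => by
      funext v; unfold demL; congr
  simp only [key]
  generalize hp : pos w i = p at *
  generalize hq : pos w (i + 1) = q at *
  generalize hr : pos w (i + 1 + 1) = r at *
  rcases lt_or_gt_of_ne hne1 with h1 | h1 <;> rcases lt_or_gt_of_ne hne2 with h2 | h2 <;>
    rcases lt_or_gt_of_ne hne3 with h3 | h3 <;>
    first
    | exact absurd h3 (not_lt.mpr (h1.trans h2).le)
    | simp [pos_simple_mul, e1, e2, hp, hq, hr, h1, h2, h3, h1.not_gt, h2.not_gt, h3.not_gt, hb']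

/-- The linear action of `H` on `ℤ[S_∞]`. -/
noncomputable def demRep : Demazure →ₐ[ℤ] Module.End ℤ (SInf →₀ ℤ) :=
  RingQuot.liftAlgHom ℤ ⟨FreeAlgebra.lift ℤ fun k => Finsupp.lmapDomain ℤ ℤ (demL k), by
    intro x y h
    cases h with
    | idem i =>
      simp only [map_mul, FreeAlgebra.lift_ι_apply, Module.End.mul_eq_comp,
        ← Finsupp.lmapDomain_comp]
      congr 1; funext w; exact demL_idem i w
    | comm i j h =>
      simp only [map_mul, FreeAlgebra.lift_ι_apply, Module.End.mul_eq_comp,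
        ← Finsupp.lmapDomain_comp]
      congr 1; funext w
      rcases h with h | h
      · exact demL_comm i j h w
      · exact (demL_comm j i h w).symm
    | braid i =>
      simp only [map_mul, FreeAlgebra.lift_ι_apply, Module.End.mul_eq_comp,
        ← Finsupp.lmapDomain_comp]
      congr 1; funext w; exact demL_braid i w⟩

theorem demRep_wordElt (a : List ℕ+) (w : SInf) :
    demRep (wordElt a) (Finsupp.single w 1) = Finsupp.single (a.foldr demL w) 1 := by
  induction a with
  | nil => simp [wordElt]
  | cons k a ih =>
    have : wordElt (k :: a) = gen k * wordElt a := by simp [wordElt]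
    rw [this, map_mul, Module.End.mul_apply, ih]
    simp [demRep, gen, Finsupp.mapDomain_single]

/-- The Demazure product of the letters of a word, as a permutation. -/
noncomputable def demFold (a : List ℕ+) : SInf := a.foldr demL 1

theorem demFold_eq_of_wordElt_eq {a b : List ℕ+} (h : wordElt a = wordElt b) :
    demFold a = demFold b := by
  have h1 := demRep_wordElt a 1
  rw [h, demRep_wordElt b 1] at h1
  exact (Finsupp.single_left_injective one_ne_zero h1).symm

/-- Exchange: if `w⁻¹` inverts `x < y`, then deleting a letter from a word for `w` gives a word for
`(x y) w`. -/
theorem exchange (a : List ℕ+) : ∀ (w : SInf), IsWord a w → ∀ x y : ℕ+, x < y →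
    pos w y < pos w x →
    ∃ (b : List ℕ+) (v : SInf), IsWord b v ∧ b.length + 1 = a.length ∧
      (v : Equiv.Perm ℕ+) = Equiv.swap x y * w := by
  induction a with
  | nil =>
    rintro w rfl x y hxy h
    exact absurd hxy (show y < x from h).not_gt
  | cons k a ih =>
    rintro w rfl x y hxy h
    set w' : SInf := (a.map simple).prod with hw'
    have hw : ((k :: a).map simple).prod = simple k * w' := by simp [hw']
    rw [hw] at h ⊢
    rw [pos_simple_mul, pos_simple_mul] at h
    by_cases hk : x = k ∧ y = k + 1
    · obtain ⟨rfl, rfl⟩ := hk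
      refine ⟨a, w', rfl, rfl, ?_⟩
      rw [Subgroup.coe_mul, ← mul_assoc]
      change _ = Equiv.swap x (x + 1) * Equiv.swap x (x + 1) * _
      rw [Equiv.swap_mul_self, one_mul]
    · have hlt : Equiv.swap k (k + 1) x < Equiv.swap k (k + 1) y := by
        have hs : ∀ z : ℕ+, ((z + 1 : ℕ+) : ℕ) = z + 1 := fun z => rfl
        simp only [Equiv.swap_apply_def, ← PNat.coe_lt_coe, ← PNat.coe_inj, hs] at hk hxy ⊢
        split_ifs <;> simp only [hs] at * <;> omega
      obtain ⟨b, v, hb, hl, hv⟩ := ih w' rfl _ _ hlt h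
      refine ⟨k :: b, simple k * v, by simpa [IsWord] using hb, by simp [hl], ?_⟩
      rw [Subgroup.coe_mul, hv, Subgroup.coe_mul, ← mul_assoc, ← mul_assoc]
      congr 1
      have := Equiv.swap_apply_apply (Equiv.swap k (k + 1)) x y
      rw [this]
      change Equiv.swap k (k + 1) * (_ * _ * _) = _ * Equiv.swap k (k + 1)
      rw [Equiv.swap_inv, ← mul_assoc, ← mul_assoc, Equiv.swap_mul_self, one_mul]

theorem len_le_of_isWord {a : List ℕ+} {w : SInf} (h : IsWord a w) : len w ≤ a.length :=
  Nat.sInf_le ⟨a, h, rfl⟩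

theorem len_simple_mul_of_descent (k : ℕ+) (w : SInf)
    (h : pos w (k + 1) < pos w k) :
    len w = len (simple k * w) + 1 := by
  obtain ⟨a, ha, hl⟩ := exists_isReducedWord w
  obtain ⟨b, v, hb, hbl, hv⟩ := exchange a w ha k (k + 1) (PNat.lt_add_right k 1) h
  have hv' : v = simple k * w := Subtype.ext hv
  subst hv'
  obtain ⟨c, hc, hcl⟩ := exists_isReducedWord (simple k * w)
  have h1 := len_le_of_isWord hb
  have h2 : IsWord (k :: c) w := by
    have : (c.map simple).prod = simple k * w := hc
    simp [IsWord, this, ← mul_assoc, simple_mul_self]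
  have h3 := len_le_of_isWord h2
  simp at h3
  omega

theorem len_simple_mul_of_ascent (k : ℕ+) (w : SInf)
    (h : pos w k < pos w (k + 1)) :
    len (simple k * w) = len w + 1 := by
  have := len_simple_mul_of_descent k (simple k * w) (by simpa [pos_simple_mul] using h)
  rwa [← mul_assoc, simple_mul_self, one_mul] at this

theorem IsReducedWord.tail {k : ℕ+} {a : List ℕ+} {w : SInf} (h : IsReducedWord (k :: a) w) :
    IsReducedWord a (simple k * w) ∧
      pos w (k + 1) < pos w k := by
  obtain ⟨h1, h2⟩ := h
  have h3 : IsWord a (simple k * w) := by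
    have : simple k * (a.map simple).prod = w := by simpa [IsWord] using h1
    rw [← this, ← mul_assoc, simple_mul_self, one_mul]; rfl
  have h4 := len_le_of_isWord h3
  simp only [List.length_cons] at h2
  rcases lt_trichotomy (pos w (k + 1)) (pos w k) with h | h | h
  · have := len_simple_mul_of_descent k w h
    exact ⟨⟨h3, by omega⟩, h⟩
  · exact absurd (pos_injective w h) (PNat.lt_add_right k 1).ne'
  · have := len_simple_mul_of_ascent k w h
    omega

theorem IsReducedWord.cons {k : ℕ+} {a : List ℕ+} {w : SInf} (h : IsReducedWord a w)
    (hk : pos w k < pos w (k + 1)) :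
    IsReducedWord (k :: a) (simple k * w) := by
  refine ⟨?_, by rw [len_simple_mul_of_ascent k w hk, ← h.2, List.length_cons]⟩
  have : (a.map simple).prod = w := h.1
  simp [IsWord, this]

theorem IsReducedWord.cons_of_descent {k : ℕ+} {c : List ℕ+} {w : SInf}
    (h : IsReducedWord c (simple k * w)) (hk : pos w (k + 1) < pos w k) :
    IsReducedWord (k :: c) w := by
  have := h.cons (k := k) (by simpa [pos_simple_mul] using hk)
  rwa [← mul_assoc, simple_mul_self, one_mul] at this

theorem wordElt_cons (k : ℕ+) (a : List ℕ+) : wordElt (k :: a) = gen k * wordElt a := by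
  simp [wordElt]

theorem gen_idem (i : ℕ+) : gen i * gen i = gen i := by
  unfold gen
  rw [← map_mul]
  exact RingQuot.mkAlgHom_rel ℤ (.idem i)

theorem gen_comm (i j : ℕ+) (h : i + 1 < j) : gen i * gen j = gen j * gen i := by
  unfold gen
  rw [← map_mul, ← map_mul]
  exact RingQuot.mkAlgHom_rel ℤ (.comm i j (Or.inl h))

theorem gen_braid (i : ℕ+) :
    gen i * gen (i + 1) * gen i = gen (i + 1) * gen i * gen (i + 1) := by
  unfold gen
  simp only [← map_mul]
  exact RingQuot.mkAlgHom_rel ℤ (.braid i)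

/-- Any two reduced words for the same permutation give the same element of `H`. -/
theorem wordElt_eq_of_isReducedWord (n : ℕ) : ∀ (a b : List ℕ+) (w : SInf), len w = n →
    IsReducedWord a w → IsReducedWord b w → wordElt a = wordElt b := by
  induction n with
  | zero =>
    intro a b w hw ha hb
    have h1 := ha.2
    have h2 := hb.2
    rw [hw, List.length_eq_zero_iff] at h1 h2
    rw [h1, h2]
  | succ n ih =>
    have main : ∀ (i j : ℕ+) (a b : List ℕ+) (w : SInf), len w = n + 1 → i < j →
        IsReducedWord (i :: a) w → IsReducedWord (j :: b) w →
        wordElt (i :: a) = wordElt (j :: b) := by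
      intro i j a b w hw hij ha hb
      obtain ⟨ha1, ha2⟩ := ha.tail
      obtain ⟨hb1, hb2⟩ := hb.tail
      have li := len_simple_mul_of_descent i w ha2
      have lj := len_simple_mul_of_descent j w hb2
      have a1 : i < i + 1 := PNat.lt_add_right i 1
      have a2 : j < j + 1 := PNat.lt_add_right j 1
      rcases (PNat.add_one_le_iff.mpr hij).lt_or_eq with h | rfl
      · obtain ⟨c, hc⟩ := exists_isReducedWord (simple j * (simple i * w))
        have e1 : Equiv.swap j (j + 1) i = i :=
          Equiv.swap_apply_of_ne_of_ne (a1.trans h).ne ((a1.trans h).trans a2).ne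
        have e2 : Equiv.swap j (j + 1) (i + 1) = i + 1 :=
          Equiv.swap_apply_of_ne_of_ne h.ne (h.trans a2).ne
        have e3 : Equiv.swap i (i + 1) j = j :=
          Equiv.swap_apply_of_ne_of_ne (a1.trans h).ne' h.ne'
        have e4 : Equiv.swap i (i + 1) (j + 1) = j + 1 :=
          Equiv.swap_apply_of_ne_of_ne ((a1.trans h).trans a2).ne' (h.trans a2).ne'
        have h1 : IsReducedWord (j :: c) (simple i * w) :=
          hc.cons_of_descent (by simpa [pos_simple_mul, e3, e4] using hb2)
        rw [← mul_assoc, ← simple_comm i j h, mul_assoc] at hc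
        have h2 : IsReducedWord (i :: c) (simple j * w) :=
          hc.cons_of_descent (by simpa [pos_simple_mul, e1, e2] using ha2)
        rw [wordElt_cons, ih a (j :: c) _ (by omega) ha1 h1, wordElt_cons j b,
          ih b (i :: c) _ (by omega) hb1 h2, wordElt_cons, wordElt_cons, ← mul_assoc,
          gen_comm i j h, mul_assoc]
      · obtain ⟨c, hc⟩ := exists_isReducedWord (simple i * (simple (i + 1) * (simple i * w)))
        have e1 : Equiv.swap i (i + 1) (i + 1 + 1) = i + 1 + 1 :=
          Equiv.swap_apply_of_ne_of_ne (a1.trans a2).ne' a2.ne'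
        have e2 : Equiv.swap (i + 1) (i + 1 + 1) i = i :=
          Equiv.swap_apply_of_ne_of_ne a1.ne (a1.trans a2).ne
        have h1 : IsReducedWord ((i + 1) :: i :: c) (simple i * w) :=
          (hc.cons_of_descent (by simpa [pos_simple_mul, e1, e2] using hb2)).cons_of_descent
            (by simpa [pos_simple_mul, e1, e2] using hb2.trans ha2)
        have hbr : simple i * (simple (i + 1) * (simple i * w)) =
            simple (i + 1) * (simple i * (simple (i + 1) * w)) := by
          simp only [← mul_assoc, simple_braid i]
        rw [hbr] at hc
        have h2 : IsReducedWord (i :: (i + 1) :: c) (simple (i + 1) * w) :=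
          (hc.cons_of_descent (by simpa [pos_simple_mul, e1, e2] using ha2)).cons_of_descent
            (by simpa [pos_simple_mul, e1, e2] using hb2.trans ha2)
        rw [wordElt_cons, ih a _ _ (by omega) ha1 h1, wordElt_cons (i + 1) b,
          ih b _ _ (by omega) hb1 h2]
        simp only [wordElt_cons, ← mul_assoc, gen_braid i]
    intro a b w hw ha hb
    match a, b, ha, hb with
    | [], _, ha, _ => exact absurd ha.2 (by simp [hw])
    | _ :: _, [], _, hb => exact absurd hb.2 (by simp [hw])
    | i :: a, j :: b, ha, hb =>
      rcases lt_trichotomy i j with h | rfl | h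
      · exact main i j a b w hw h ha hb
      · obtain ⟨ha1, ha2⟩ := ha.tail
        have li := len_simple_mul_of_descent i w ha2
        rw [wordElt_cons, wordElt_cons, ih a b _ (by omega) ha1 hb.tail.1]
      · exact (main j i b a w hw h hb ha).symm

/-- The basis element of `H` identified with `w ∈ S_∞`: `∂(a)` for a reduced word `a` of `w`
(by `basisElt_eq` below, the choice does not matter). -/
noncomputable def basisElt (w : SInf) : Demazure := wordElt (exists_isReducedWord w).choose

theorem basisElt_eq {a : List ℕ+} {w : SInf} (h : IsReducedWord a w) : basisElt w = wordElt a :=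
  wordElt_eq_of_isReducedWord _ _ _ w rfl (exists_isReducedWord w).choose_spec h

theorem demFold_of_isReducedWord (a : List ℕ+) :
    ∀ w : SInf, IsReducedWord a w → demFold a = w := by
  induction a with
  | nil => rintro w ⟨rfl, -⟩; rfl
  | cons k a ih =>
    intro w h
    obtain ⟨h1, h2⟩ := h.tail
    have h3 : demFold (k :: a) = demL k (demFold a) := rfl
    rw [h3, ih _ h1, demL, if_pos (by simpa [pos_simple_mul] using h2), ← mul_assoc,
      simple_mul_self, one_mul]

theorem basisElt_injective : Function.Injective basisElt := by
  intro u v h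
  obtain ⟨a, ha⟩ := exists_isReducedWord u
  obtain ⟨b, hb⟩ := exists_isReducedWord v
  rw [basisElt_eq ha, basisElt_eq hb] at h
  rw [← demFold_of_isReducedWord a u ha, demFold_eq_of_wordElt_eq h,
    demFold_of_isReducedWord b v hb]

theorem gen_mul_basisElt (k : ℕ+) (w : SInf) : gen k * basisElt w = basisElt (demL k w) := by
  unfold demL
  split_ifs with h
  · obtain ⟨a, ha⟩ := exists_isReducedWord w
    rw [basisElt_eq ha, basisElt_eq (ha.cons h), wordElt_cons]
  · have h' : pos w (k + 1) < pos w k :=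
      lt_of_le_of_ne (not_lt.mp h) fun e => (PNat.lt_add_right k 1).ne' (pos_injective w e)
    obtain ⟨a, ha⟩ := exists_isReducedWord (simple k * w)
    rw [basisElt_eq (ha.cons_of_descent h'), wordElt_cons, ← mul_assoc, gen_idem]

theorem basisElt_one : basisElt 1 = 1 := by
  have h : IsReducedWord [] 1 := ⟨rfl, (Nat.le_zero.mp (len_le_of_isWord (a := []) rfl)).symm⟩
  rw [basisElt_eq h]; rfl

theorem wordElt_eq_basisElt (a : List ℕ+) : wordElt a = basisElt (demFold a) := by
  induction a with
  | nil => exact basisElt_one.symm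
  | cons k a ih => rw [wordElt_cons, ih, gen_mul_basisElt]; rfl

theorem basisElt_simple (k : ℕ+) : basisElt (simple k) = gen k := by
  have h := gen_mul_basisElt k 1
  rw [demL, if_pos (show pos 1 k < pos 1 (k + 1) from PNat.lt_add_right k 1), basisElt_one, mul_one,
    mul_one] at h
  exact h.symm

theorem len_demFold_le (a : List ℕ+) : len (demFold a) ≤ a.length := by
  induction a with
  | nil => exact len_le_of_isWord (a := []) rfl
  | cons k a ih =>
    change len (demL k (demFold a)) ≤ a.length + 1
    unfold demL
    split_ifs with h
    · rw [len_simple_mul_of_ascent k _ h]; omega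
    · omega

theorem not_preserves_of_mem (k : ℕ+) (a : List ℕ+) (h : k ∈ a) :
    ¬ ∀ x, pos (demFold a) x ≤ k ↔ x ≤ k := by
  induction a with
  | nil => simp at h
  | cons j a ih =>
    change ¬ ∀ x, pos (demL j (demFold a)) x ≤ k ↔ x ≤ k
    intro hp
    by_cases hj : k = j
    · subst hj
      have h1 := (hp k).mpr le_rfl
      have h2 := (not_congr (hp (k + 1))).mpr (PNat.lt_add_right k 1).not_ge
      have h3 := h1.trans_lt (not_le.mp h2)
      unfold demL at h3
      split_ifs at h3 with hlt
      · simp only [pos_simple_mul, Equiv.swap_apply_left, Equiv.swap_apply_right] at h3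
        exact h3.not_gt hlt
      · exact hlt h3
    · refine ih ((List.mem_cons.mp h).resolve_left hj) fun x => ?_
      unfold demL at hp
      split_ifs at hp with hlt
      · have := hp (Equiv.swap j (j + 1) x)
        rw [pos_simple_mul, Equiv.swap_apply_self] at this
        rw [this]
        have hs : ∀ z : ℕ+, ((z + 1 : ℕ+) : ℕ) = z + 1 := fun z => rfl
        simp only [Equiv.swap_apply_def, ← PNat.coe_le_coe, ← PNat.coe_inj, hs] at hj ⊢
        split_ifs <;> simp only [hs] at * <;> omega
      · exact hp x

/-- The letters of a word are bounded in terms of its Demazure product. -/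
theorem exists_letter_bound (w : SInf) :
    ∃ N : ℕ+, ∀ a : List ℕ+, demFold a = w → ∀ k ∈ a, k < N := by
  obtain ⟨N, hN⟩ := Set.Finite.bddAbove w.2
  refine ⟨N + 1, ?_⟩
  rintro a rfl k hk
  by_contra hlt
  rw [not_lt, PNat.add_one_le_iff] at hlt
  have hfix : ∀ x, N < x → pos (demFold a) x = x := fun x hx => by
    unfold pos
    rw [Equiv.Perm.inv_eq_iff_eq]
    by_contra h
    exact (hN (show x ∈ {i | _} from fun h' => h h'.symm)).not_gt hx
  refine not_preserves_of_mem k a hk fun x => ?_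
  by_cases hx : N < x
  · rw [hfix x hx]
  · have h2 : ¬ N < pos (demFold a) x := fun h => hx (by
      have h3 := pos_injective _ (hfix _ h)
      rwa [h3] at h)
    exact ⟨fun _ => (not_lt.mp hx).trans hlt.le, fun _ => (not_lt.mp h2).trans hlt.le⟩

/-- A pipe dream: a finite set of positions `(i, j) ∈ ℤ²` (row `i`, column `j`) with
`i + j - 1 ≥ 1`. -/
def PD : Type := {P : Finset (ℤ × ℤ) // ∀ p ∈ P, 1 ≤ p.1 + p.2 - 1}

/-- The letter `i + j - 1` of a position `(i, j)`, which is positive on the positions allowed in a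
pipe dream. -/
def letter (p : ℤ × ℤ) : ℕ+ := (p.1 + p.2 - 1).toNat.toPNat'

/-- The word of a pipe dream: the values `i + j - 1` of its positions `(i, j)`, read row by row
from top to bottom (increasing `i`), each row from right to left (decreasing `j`). -/
def PD.word (P : PD) : List ℕ+ :=
  ((P.1.map ⟨fun p => (toLex (p.1, OrderDual.toDual p.2) : ℤ ×ₗ ℤᵒᵈ), fun p q h => by
      simpa [Prod.ext_iff] using h⟩).sort (· ≤ ·)).map
    fun q => letter ((ofLex q).1, OrderDual.ofDual (ofLex q).2)

/-- `P ∈ PD(w)`: the permutation `∂(P)` of `P` is `w`. -/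
def PD.HasPerm (P : PD) (w : SInf) : Prop := wordElt P.word = basisElt w

theorem PD.letter_mem_word (P : PD) {p : ℤ × ℤ} (hp : p ∈ P.1) : letter p ∈ P.word := by
  unfold PD.word
  rw [List.mem_map]
  refine ⟨toLex (p.1, OrderDual.toDual p.2), ?_, rfl⟩
  rw [Finset.mem_sort, Finset.mem_map]
  exact ⟨p, hp, rfl⟩

theorem PD.length_word (P : PD) : P.word.length = P.1.card := by
  simp [PD.word]

theorem PD.hasPerm_iff (P : PD) (w : SInf) : P.HasPerm w ↔ demFold P.word = w := by
  unfold PD.HasPerm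
  rw [wordElt_eq_basisElt, basisElt_injective.eq_iff]

theorem PD.HasPerm.len_le {P : PD} {w : SInf} (h : P.HasPerm w) : len w ≤ P.1.card := by
  rw [← (P.hasPerm_iff w).mp h, ← P.length_word]
  exact len_demFold_le _

/-- A pipe dream is stable if all its positions are in rows `1, 2, 3, …`. -/
def PD.Stable (P : PD) : Prop := ∀ p ∈ P.1, 1 ≤ p.1

/-- The set of stable pipe dreams with permutation `w`. -/
def stablePD (w : SInf) : Set PD := {P | P.Stable ∧ P.HasPerm w}

/-- The power series in variables `x_i`, `i ∈ ℤ`, over `ℤ[β]`; here `β` is `Polynomial.X`. -/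
abbrev Series : Type := MvPowerSeries ℤ (Polynomial ℤ)

/-- The weight `β^{|P| - ℓ(w)} ∏_{(i, j) ∈ P} x_i` of `P ∈ PD(w)`
(note `|P| ≥ ℓ(w)` by `PD.HasPerm.len_le`). -/
noncomputable def PD.wt (P : PD) (w : SInf) : Series :=
  MvPowerSeries.C (Polynomial.X ^ (P.1.card - len w)) * ∏ p ∈ P.1, MvPowerSeries.X p.1

theorem PD.coeff_wt (P : PD) (w : SInf) (m : ℤ →₀ ℕ) :
    MvPowerSeries.coeff m (P.wt w) =
      if m = ∑ p ∈ P.1, Finsupp.single p.1 1 then Polynomial.X ^ (P.1.card - len w) else 0 := by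
  classical
  have h : ∀ s : Finset (ℤ × ℤ), ∏ p ∈ s, (MvPowerSeries.X p.1 : Series) =
      MvPowerSeries.monomial (∑ p ∈ s, Finsupp.single p.1 1) 1 := by
    intro s
    induction s using Finset.induction_on with
    | empty => simp
    | insert p s hp ih =>
      rw [Finset.prod_insert hp, Finset.sum_insert hp, ih, MvPowerSeries.X,
        MvPowerSeries.monomial_mul_monomial, one_mul]
  rw [PD.wt, h, MvPowerSeries.coeff_C_mul, MvPowerSeries.coeff_monomial]
  split_ifs <;> simp

theorem finite_support_coeff_wt (w : SInf) (m : ℤ →₀ ℕ) :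
    {P ∈ stablePD w | MvPowerSeries.coeff m (P.wt w) ≠ 0}.Finite := by
  obtain ⟨N, hN⟩ := exists_letter_bound w
  have hf : Set.Finite {Q : Finset (ℤ × ℤ) | Q ⊆ m.support.biUnion fun i =>
      (Finset.Icc (2 - i) (N + 1 - i)).map ⟨fun j => (i, j), fun _ _ h => (Prod.ext_iff.mp h).2⟩} :=
    (Finset.finite_toSet (Finset.powerset _)).subset fun Q hQ => by simpa using hQ
  refine Set.Finite.of_finite_image (f := Subtype.val) (hf.subset ?_) Subtype.val_injective.injOn
  rintro _ ⟨P, ⟨⟨-, hP⟩, hm⟩, rfl⟩ p hp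
  rw [PD.coeff_wt] at hm
  have hm' : m = ∑ p ∈ P.1, Finsupp.single p.1 1 := by
    by_contra h
    exact hm (if_neg h)
  have h1 : p.1 ∈ m.support := by
    rw [Finsupp.mem_support_iff, hm', Finsupp.finsetSum_apply]
    refine (lt_of_lt_of_le (show 0 < (Finsupp.single p.1 1 : ℤ →₀ ℕ) p.1 by simp)
      (Finset.single_le_sum (f := fun q : ℤ × ℤ => (Finsupp.single q.1 1 : ℤ →₀ ℕ) p.1)
        (fun _ _ => Nat.zero_le _) hp)).ne'
  have h2 := hN _ ((P.hasPerm_iff w).mp hP) _ (P.letter_mem_word hp)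
  have h3 := P.2 p hp
  have h4 : ((letter p : ℕ) : ℤ) = p.1 + p.2 - 1 := by
    unfold letter
    rw [Nat.toPNat'_coe, if_pos (by omega)]
    omega
  rw [← PNat.coe_lt_coe] at h2
  rw [Finset.mem_biUnion]
  refine ⟨p.1, h1, ?_⟩
  rw [Finset.mem_map]
  refine ⟨p.2, ?_, rfl⟩
  rw [Finset.mem_Icc]
  omega

/-- The `K`-Stanley symmetric function `G_w^{(β)}`, the sum of the weights of the stable pipe dreams
with permutation `w`, as a formal power series: each coefficient is the sum of the coefficients of
the weights, all but finitely many of which vanish (see `finite_support_coeff_wt`). -/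
noncomputable def kStanley (w : SInf) : Series :=
  fun m => ∑ᶠ P ∈ stablePD w, MvPowerSeries.coeff m (P.wt w)

/-- The pairs `(k, v)` with `w = s_k * v` in the Demazure algebra. -/
def leftFactors (w : SInf) : Set (ℕ+ × SInf) :=
  {q | basisElt w = basisElt (simple q.1) * basisElt q.2}

/-- The pairs `(k, u)` with `w = u * s_k` in the Demazure algebra. -/
def rightFactors (w : SInf) : Set (ℕ+ × SInf) :=
  {q | basisElt w = basisElt q.2 * basisElt (simple q.1)}

theorem finite_leftFactors (w : SInf) : (leftFactors w).Finite := by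
  obtain ⟨N, hN⟩ := exists_letter_bound w
  refine ((Set.finite_Iio N).biUnion fun k _ =>
    (Set.toFinite {(k, w), (k, simple k * w)})).subset ?_
  rintro ⟨k, v⟩ h
  change basisElt w = basisElt (simple k) * basisElt v at h
  rw [basisElt_simple, gen_mul_basisElt, basisElt_injective.eq_iff] at h
  obtain ⟨a, ha⟩ := exists_isReducedWord v
  have hk := hN (k :: a) (by
    rw [h, ← demFold_of_isReducedWord a v ha]; rfl) k (by simp)
  refine Set.mem_biUnion (show k ∈ Set.Iio N from hk) ?_
  unfold demL at h
  split_ifs at h with hlt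
  · right
    rw [h, ← mul_assoc, simple_mul_self, one_mul]
    rfl
  · left
    rw [h]

theorem finite_of_bound (N : ℕ+) : {u : SInf | ∀ x, N < x → u.1 x = x}.Finite := by
  have hpi : (Set.univ.pi fun _ : Set.Iic N => Set.Iic N).Finite :=
    Set.Finite.pi fun _ => Set.finite_Iic N
  refine Set.Finite.of_injOn (f := fun u (x : Set.Iic N) => u.1 x.1) (fun u hu => ?_) ?_ hpi
  · rintro ⟨x, hx⟩ -
    change u.1 x ≤ N
    by_contra h
    have h2 := u.1.injective (hu _ (not_le.mp h))
    rw [h2] at h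
    exact h hx
  · intro u hu v hv huv
    refine Subtype.ext (Equiv.ext fun x => ?_)
    by_cases hx : N < x
    · rw [hu x hx, hv x hx]
    · exact congrFun huv ⟨x, not_lt.mp hx⟩

theorem finite_rightFactors (w : SInf) : (rightFactors w).Finite := by
  obtain ⟨N, hN⟩ := exists_letter_bound w
  refine ((Set.finite_Iio N).prod (finite_of_bound N)).subset ?_
  rintro ⟨k, u⟩ h
  change basisElt w = basisElt u * basisElt (simple k) at h
  obtain ⟨a, ha⟩ := exists_isReducedWord u
  have h1 : basisElt w = wordElt (a ++ [k]) := by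
    rw [h, basisElt_eq ha, basisElt_simple]; simp [wordElt]
  rw [wordElt_eq_basisElt, basisElt_injective.eq_iff] at h1
  have h2 := hN _ h1.symm
  refine ⟨h2 k (by simp), ?_⟩
  have h3 : ∀ l ∈ a, l < N := fun l hl => h2 l (by simp [hl])
  intro x hx
  obtain ⟨rfl, -⟩ := ha
  clear h h1 h2
  induction a with
  | nil => rfl
  | cons l a ih =>
    have ih' := ih (fun l hl => h3 l (by simp [hl]))
    have hl := h3 l (by simp)
    rw [List.map_cons, List.prod_cons, Subgroup.coe_mul, Equiv.Perm.mul_apply, ih']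
    exact Equiv.swap_apply_of_ne_of_ne (hl.trans hx).ne'
      ((PNat.add_one_le_iff.mpr hl).trans_lt hx).ne'

open Classical in
/-- `β^{δ_{w,v}}`: this is `β` if `w = v` and `1` otherwise. -/
noncomputable def betaDelta (w v : SInf) : Series :=
  MvPowerSeries.C (Polynomial.X ^ (if w = v then 1 else 0))

end PipeDream

/-!
Let `A(x) = ⋯ (1 + x e_3) (1 + x e_2) (1 + x e_1)`. Expanding the product `A(x_1) A(x_2) ⋯` over the
Demazure algebra `H` gives the sum of `x^P ∂(P)` over all stable pipe dreams `P`, since `P` is read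
by rows, each with decreasing letters. The theorem expresses that this sum commutes with
`E = e_1 + e_2 + ⋯`.

Indeed, if `w = s_k * v` or `w = v * s_k`, then `v = w` or `ℓ(w) = ℓ(v) + 1`. In both cases a pipe
dream `P` of `v` contributes `β^{|P| + 1 - ℓ(w)} x^P`, so the coefficient of `x^m` on either side is
one fixed power of `β` times the number of pairs `(k, P)` with `P` of weight `x^m` and
`s_k * ∂(P) = w`, respectively `∂(P) * s_k = w` (`coeff_finsum_factors`). These numbers are the
coefficients of `x^m w` in `E A(x_1) A(x_2) ⋯` and in `A(x_1) A(x_2) ⋯ E`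
(`sum_grid_cons_eq_append`).

That `E` commutes with each `A(x)` is `commute_sum_prod_one_add`. To stay with finite sums, the
letters are bounded in terms of `w` and the rows restricted to the support of `m`; the products then
live in the monoid algebra of `ℤ →₀ ℕ` over `H`.
-/

namespace PipeDream

/-! ### Right multiplication in the Demazure algebra -/

/-- The anti-automorphism of the Demazure algebra that fixes every generator. -/
noncomputable def demazureRev : Demazure →ₐ[ℤ] Demazureᵐᵒᵖ :=
  RingQuot.liftAlgHom ℤ ⟨FreeAlgebra.lift ℤ fun k => MulOpposite.op (gen k), by
    intro x y h
    cases h with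
    | idem i =>
      simp only [map_mul, FreeAlgebra.lift_ι_apply, ← MulOpposite.op_mul, gen_idem]
    | comm i j h =>
      simp only [map_mul, FreeAlgebra.lift_ι_apply, ← MulOpposite.op_mul]
      rcases h with h | h
      · rw [gen_comm i j h]
      · rw [gen_comm j i h]
    | braid i =>
      simp only [map_mul, FreeAlgebra.lift_ι_apply, ← MulOpposite.op_mul, ← mul_assoc, gen_braid]⟩

theorem demazureRev_gen (k : ℕ+) : demazureRev (gen k) = MulOpposite.op (gen k) := by
  simp [demazureRev, gen]

theorem demazureRev_wordElt (a : List ℕ+) :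
    demazureRev (wordElt a) = MulOpposite.op (wordElt a.reverse) := by
  induction a with
  | nil => simp [wordElt]
  | cons k a ih =>
    rw [wordElt_cons, map_mul, ih, demazureRev_gen, ← MulOpposite.op_mul]
    simp [wordElt]

theorem IsWord.reverse {a : List ℕ+} {w : SInf} (h : IsWord a w) : IsWord a.reverse w⁻¹ := by
  have h' : (a.map simple).prod = w := h
  rw [IsWord, ← h', List.prod_inv_reverse, List.map_map, List.map_reverse]
  congr 2

theorem len_inv (w : SInf) : len w⁻¹ = len w := by
  have key : ∀ v : SInf, len v⁻¹ ≤ len v := fun v => by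
    obtain ⟨a, ha, hl⟩ := exists_isReducedWord v
    simpa [hl] using len_le_of_isWord ha.reverse
  exact (key w).antisymm (by simpa using key w⁻¹)

/-- The anti-automorphism of `H` sends the basis element of `w` to that of `w⁻¹`; this turns right
factors into left factors. -/
theorem demFold_reverse (a : List ℕ+) : demFold a.reverse = (demFold a)⁻¹ := by
  obtain ⟨b, hb⟩ := exists_isReducedWord (demFold a)
  have h1 : wordElt a = wordElt b := by rw [wordElt_eq_basisElt, basisElt_eq hb]
  have h2 := congrArg demazureRev h1
  rw [demazureRev_wordElt, demazureRev_wordElt, MulOpposite.op_inj] at h2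
  rw [demFold_eq_of_wordElt_eq h2]
  refine demFold_of_isReducedWord _ _ ⟨hb.1.reverse, ?_⟩
  rw [List.length_reverse, hb.2, len_inv]

theorem len_demL (k : ℕ+) (w : SInf) : demL k w = w ∨ len (demL k w) = len w + 1 := by
  unfold demL
  split_ifs with h
  · exact Or.inr (len_simple_mul_of_ascent k w h)
  · exact Or.inl rfl

theorem len_demFold_append_singleton (a : List ℕ+) (k : ℕ+) :
    demFold (a ++ [k]) = demFold a ∨ len (demFold (a ++ [k])) = len (demFold a) + 1 := by
  have h : demFold (a ++ [k]) = (demL k (demFold a)⁻¹)⁻¹ := by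
    rw [← demFold_reverse, ← inv_inj, inv_inv, ← demFold_reverse]
    simp [demFold]
  rw [h, len_inv, inv_eq_iff_eq_inv, ← len_inv (demFold a)]
  exact len_demL k _

theorem mem_leftFactors_iff (w : SInf) (k : ℕ+) (a : List ℕ+) :
    (k, demFold a) ∈ leftFactors w ↔ demFold (k :: a) = w := by
  change basisElt w = basisElt (simple k) * basisElt (demFold a) ↔ _
  rw [basisElt_simple, gen_mul_basisElt, basisElt_injective.eq_iff, eq_comm]
  rfl

theorem mem_rightFactors_iff (w : SInf) (k : ℕ+) (a : List ℕ+) :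
    (k, demFold a) ∈ rightFactors w ↔ demFold (a ++ [k]) = w := by
  change basisElt w = basisElt (demFold a) * basisElt (simple k) ↔ _
  have h : wordElt (a ++ [k]) = wordElt a * gen k := by simp [wordElt]
  rw [basisElt_simple, ← wordElt_eq_basisElt, ← h, wordElt_eq_basisElt, basisElt_injective.eq_iff,
    eq_comm]

theorem exists_demFold_eq (v : SInf) : ∃ a, demFold a = v :=
  (exists_isReducedWord v).imp fun a ha => demFold_of_isReducedWord a v ha

/-! ### The row operators commute with the sum of the generators -/

/-- By induction: when the factor `1 + x e_{n+1}` and the summand `e_{n+1}` are added, the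
commutator of the sum with the new factor and that of `e_{n+1}` with the old product cancel, because
`[e_n, e_{n+1}] e_n = e_{n+1} [e_n, e_{n+1}]` by the idempotent and braid relations. -/
theorem commute_sum_prod_one_add {R : Type*} [Ring R] (e : ℕ → R) (x : R)
    (hx : ∀ i, Commute x (e i)) (idem : ∀ i, e i * e i = e i)
    (comm : ∀ i j, i + 1 < j → e i * e j = e j * e i)
    (braid : ∀ i, e i * e (i + 1) * e i = e (i + 1) * e i * e (i + 1)) (n : ℕ) :
    Commute (∑ i ∈ Finset.range n, e i)
      ((List.range n).reverse.map fun i => 1 + x * e i).prod := by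
  set A : ℕ → R := fun n => ((List.range n).reverse.map fun i => 1 + x * e i).prod with hA
  have hA1 : ∀ n, A (n + 1) = (1 + x * e n) * A n := fun n => by
    simp [hA, List.range_succ]
  have hcomm : ∀ n, Commute (e (n + 1)) (A n) := fun n => by
    refine Commute.list_prod_right _ _ fun y hy => ?_
    simp only [List.mem_map, List.mem_reverse, List.mem_range] at hy
    obtain ⟨i, hi, rfl⟩ := hy
    exact (Commute.one_right _).add_right
      ((hx _).symm.mul_right (comm i (n + 1) (by omega)).symm)
  change Commute (∑ i ∈ Finset.range n, e i) (A n)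
  induction n with
  | zero => simp
  | succ n ih =>
    rcases n with _ | n
    · simp only [zero_add, Finset.sum_range_one, hA]
      simpa using (Commute.one_right _).add_right ((hx 0).symm.mul_right (Commute.refl (e 0)))
    · set S := ∑ i ∈ Finset.range n, e i with hS
      set a := e n with ha
      set b := e (n + 1) with hb
      have hSb : Commute S b := Commute.sum_left _ _ _ fun i hi =>
        comm i (n + 1) (by simpa using hi)
      have hBb : b * A n = A n * b := hcomm n
      have hxa : x * a = a * x := hx n
      have hxb : x * b = b * x := hx (n + 1)
      have haa : a * a = a := idem n
      have hbb : b * b = b := idem (n + 1)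
      have haba : a * b * a = b * a * b := braid n
      have hSx : S * x = x * S :=
        (Commute.sum_left _ _ _ fun i _ => (hx i).symm : Commute S x)
      have ih' : (S + a) * A (n + 1) = A (n + 1) * (S + a) := by
        rw [Finset.sum_range_succ] at ih; exact ih
      rw [Finset.sum_range_succ, Finset.sum_range_succ, ← hS, ← ha, ← hb, Commute, SemiconjBy,
        hA1 (n + 1), ← hb]
      have h1 : (S + a) * (1 + x * b) = (1 + x * b) * (S + a) + x * (a * b - b * a) := by
        have : S * (x * b) = x * b * S := by
          rw [← mul_assoc, hSx, mul_assoc, hSb.eq, mul_assoc]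
        rw [add_mul, mul_add, mul_add, this, ← mul_assoc a, ← hxa]
        noncomm_ring
      have h2 : b * A (n + 1) = A (n + 1) * b + x * (b * a - a * b) * A n := by
        rw [hA1, ← ha, mul_assoc, ← hBb, ← mul_assoc, mul_add, ← mul_assoc b, ← hxb]
        noncomm_ring
      have h3 : x * (a * b - b * a) * A (n + 1) + (1 + x * b) * (x * (b * a - a * b) * A n) = 0 := by
        have h4 : (a * b - b * a) * (1 + x * a) + (1 + x * b) * (b * a - a * b) = 0 := by
          have e1 : (a * b - b * a) * (x * a) = x * (a * b * a - b * a * a) := by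
            rw [← mul_assoc _ x, sub_mul _ _ x, mul_assoc a b x, ← hxb, mul_assoc b a x, ← hxa,
              ← mul_assoc a x, ← hxa, ← mul_assoc b x, ← hxb]
            noncomm_ring
          have e2 : b * a * a = b * a := by rw [mul_assoc, haa]
          have e3 : x * b * (b * a - a * b) = x * (b * a - b * a * b) := by
            rw [mul_assoc, mul_sub, ← mul_assoc b b, hbb, mul_assoc b a b]
          rw [mul_add, add_mul, e1, e2, e3, haba]
          noncomm_ring
        have h5 : (1 + x * b) * x = x * (1 + x * b) := by
          rw [add_mul, mul_add, mul_assoc, ← hxb, one_mul, mul_one]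
        rw [hA1, ← ha, ← mul_assoc (1 + x * b), ← mul_assoc (1 + x * b), h5]
        calc _ = x * ((a * b - b * a) * (1 + x * a) + (1 + x * b) * (b * a - a * b)) * A n := by
              noncomm_ring
          _ = 0 := by rw [h4]; simp
      calc (S + a + b) * ((1 + x * b) * A (n + 1))
          = (S + a) * (1 + x * b) * A (n + 1) + b * (1 + x * b) * A (n + 1) := by noncomm_ring
        _ = (1 + x * b) * ((S + a) * A (n + 1)) + x * (a * b - b * a) * A (n + 1)
            + (1 + x * b) * (b * A (n + 1)) := by
              rw [h1]
              have : b * (1 + x * b) = (1 + x * b) * b := by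
                rw [mul_add, add_mul, ← mul_assoc, ← hxb, mul_one, one_mul]
              rw [this]; noncomm_ring
        _ = (1 + x * b) * A (n + 1) * (S + a + b) +
            (x * (a * b - b * a) * A (n + 1) + (1 + x * b) * (x * (b * a - a * b) * A n)) := by
              rw [ih', h2]; noncomm_ring
        _ = _ := by rw [h3, add_zero]

/-! ### Generating functions of pipe dreams in a finite grid -/

/-- The subsets of a sorted list, each read in increasing order, expand the product of the
`1 + f b`. -/
theorem sum_powerset_prod_sort {α R : Type*} [LinearOrder α] [Semiring R] (f : α → R)
    (l : List α) (hl : l.Pairwise (· < ·)) :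
    ∑ t ∈ l.toFinset.powerset, ((t.sort (· ≤ ·)).map f).prod = (l.map fun b => 1 + f b).prod := by
  induction l with
  | nil => simp
  | cons a l ih =>
    rw [List.pairwise_cons] at hl
    have ha : a ∉ l.toFinset := fun h => (hl.1 a (List.mem_toFinset.mp h)).false
    rw [List.toFinset_cons, Finset.sum_powerset_insert ha, ih hl.2, List.map_cons, List.prod_cons,
      add_mul, one_mul, ← ih hl.2, Finset.mul_sum]
    congr 1
    refine Finset.sum_congr rfl fun t ht => ?_
    rw [Finset.mem_powerset] at ht
    rw [Finset.sort_insert _ (fun b hb => (hl.1 b (List.mem_toFinset.mp (ht hb))).le)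
      fun h => ha (ht h), List.map_cons, List.prod_cons]

/-- Positions, ordered as they are read: by increasing row, and by decreasing column within a row. -/
abbrev Box : Type := ℤ ×ₗ ℤᵒᵈ

/-- The position `(i, j)` in the reading order. -/
def boxEmb : ℤ × ℤ ↪ Box :=
  ⟨fun p => toLex (p.1, OrderDual.toDual p.2), fun p q h => by simpa [Prod.ext_iff] using h⟩

/-- The letter of a position. -/
def boxLetter (b : Box) : ℕ+ := letter ((ofLex b).1, OrderDual.ofDual (ofLex b).2)

theorem PD.word_eq (P : PD) : P.word = ((P.1.map boxEmb).sort (· ≤ ·)).map boxLetter := rfl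

/-- The factor `x_i e_k` that a position in row `i` with letter `k` contributes. -/
noncomputable def boxTerm (b : Box) : AddMonoidAlgebra Demazure (ℤ →₀ ℕ) :=
  .single (Finsupp.single (ofLex b).1 1) (gen (boxLetter b))

theorem prod_map_boxTerm (l : List Box) :
    (l.map boxTerm).prod = .single (l.map fun b => Finsupp.single (ofLex b).1 1).sum
      (wordElt (l.map boxLetter)) := by
  induction l with
  | nil => simp [wordElt, AddMonoidAlgebra.one_def]
  | cons b l ih =>
    rw [List.map_cons, List.prod_cons, ih, boxTerm, AddMonoidAlgebra.single_mul_single,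
      List.map_cons, List.map_cons, List.sum_cons, wordElt_cons]

/-- The exponent of the monomial `∏ x_i` over the positions `(i, j)` in `t`. -/
noncomputable def boxWeight (t : Finset Box) : ℤ →₀ ℕ := ∑ b ∈ t, Finsupp.single (ofLex b).1 1

theorem prod_sort_boxTerm (t : Finset Box) :
    ((t.sort (· ≤ ·)).map boxTerm).prod =
      .single (boxWeight t) (wordElt ((t.sort (· ≤ ·)).map boxLetter)) := by
  rw [prod_map_boxTerm, boxWeight, Finset.sum_eq_multiset_sum, ← Finset.sort_eq t (· ≤ ·),
    Multiset.map_coe, Multiset.sum_coe]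

theorem boxWeight_map (s : Finset (ℤ × ℤ)) :
    boxWeight (s.map boxEmb) = ∑ p ∈ s, Finsupp.single p.1 1 := by
  rw [boxWeight, Finset.sum_map]; rfl

/-- The position in row `i` whose letter is `k + 1`. -/
def rowBox (i : ℤ) (k : ℕ) : Box := boxEmb (i, k + 2 - i)

theorem boxLetter_rowBox (i : ℤ) (k : ℕ) : boxLetter (rowBox i k) = k.succPNat := by
  change letter (i, k + 2 - i) = _
  unfold letter
  have : (i + (k + 2 - i) - 1 : ℤ).toNat = k + 1 := by omega
  rw [this]
  rfl

/-- The positions in the rows of `R` with letters `1, …, n`, in reading order. -/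
def grid (R : Finset ℤ) (n : ℕ) : List Box :=
  (R.sort (· ≤ ·)).flatMap fun i => (List.range n).reverse.map (rowBox i)

theorem pairwise_grid (R : Finset ℤ) (n : ℕ) : (grid R n).Pairwise (· < ·) := by
  rw [grid, List.pairwise_flatMap]
  refine ⟨fun i _ => ?_, ?_⟩
  · rw [List.pairwise_map, List.pairwise_reverse]
    refine List.pairwise_lt_range.imp fun {k l} h => ?_
    refine Prod.Lex.toLex_lt_toLex.mpr (Or.inr ⟨rfl, ?_⟩)
    change OrderDual.toDual (_ : ℤ) < OrderDual.toDual _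
    rw [OrderDual.toDual_lt_toDual]
    simp only
    omega
  · refine (Finset.sortedLT_sort R).pairwise.imp fun {i j} h => ?_
    simp only [List.mem_map]
    rintro _ ⟨k, -, rfl⟩ _ ⟨l, -, rfl⟩
    exact Prod.Lex.toLex_lt_toLex.mpr (Or.inl h)

/-- The sum of the monomials `x^P ∂(P)` over the pipe dreams `P` in a finite grid. -/
noncomputable def gridSum (R : Finset ℤ) (n : ℕ) : AddMonoidAlgebra Demazure (ℤ →₀ ℕ) :=
  ∑ t ∈ (grid R n).toFinset.powerset,
    .single (boxWeight t) (wordElt ((t.sort (· ≤ ·)).map boxLetter))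

theorem commute_gridSum (R : Finset ℤ) (n : ℕ) :
    Commute (∑ k ∈ Finset.range n, .single 0 (gen k.succPNat)) (gridSum R n) := by
  have h : gridSum R n = ((R.sort (· ≤ ·)).map fun i =>
      ((List.range n).reverse.map fun k => 1 + .single (Finsupp.single i 1) (1 : Demazure) *
        .single 0 (gen k.succPNat)).prod).prod := by
    simp_rw [gridSum, ← prod_sort_boxTerm]
    rw [sum_powerset_prod_sort _ _ (pairwise_grid R n), grid, List.map_flatMap, List.flatMap,
      List.prod_flatten, List.map_map]
    congr 1
    refine List.map_congr_left fun i _ => ?_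
    simp only [Function.comp_apply, List.map_map]
    congr 1
    refine List.map_congr_left fun k _ => ?_
    simp only [Function.comp_apply, AddMonoidAlgebra.single_mul_single, boxTerm, boxLetter_rowBox,
      add_zero, one_mul]
    rfl
  rw [h]
  refine Commute.list_prod_right _ _ fun y hy => ?_
  rw [List.mem_map] at hy
  obtain ⟨i, -, rfl⟩ := hy
  refine commute_sum_prod_one_add
    (fun k => AddMonoidAlgebra.single (0 : ℤ →₀ ℕ) (gen k.succPNat)) _ ?_ ?_ ?_ ?_ n
  · intro k
    simp [Commute, SemiconjBy, AddMonoidAlgebra.single_mul_single]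
  · intro k
    simp [AddMonoidAlgebra.single_mul_single, gen_idem]
  · intro k l h
    simp only [AddMonoidAlgebra.single_mul_single]
    rw [gen_comm _ _ (by rw [← PNat.coe_lt_coe]; simpa using h)]
  · intro k
    have : (k + 1).succPNat = k.succPNat + 1 := rfl
    simp only [AddMonoidAlgebra.single_mul_single, this, gen_braid]

/-- The coefficient of the basis element of `w`, read off from the action of `H` on `ℤ[S_∞]`. -/
noncomputable def demCoeff (w : SInf) : Demazure →ₗ[ℤ] ℤ :=
  Finsupp.lapply w ∘ₗ LinearMap.applyₗ (Finsupp.single 1 1) ∘ₗ demRep.toLinearMap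

open Classical in
theorem demCoeff_wordElt (w : SInf) (a : List ℕ+) :
    demCoeff w (wordElt a) = if demFold a = w then 1 else 0 := by
  change demRep (wordElt a) (Finsupp.single 1 1) w = _
  rw [demRep_wordElt, Finsupp.single_apply]
  rfl

open Classical in
/-- Among the pipe dreams of a given weight in a finite grid, prepending a letter and appending a
letter give the permutation `w` equally often. -/
theorem sum_grid_cons_eq_append (R : Finset ℤ) (n : ℕ) (m : ℤ →₀ ℕ) (w : SInf) :
    ∑ t ∈ (grid R n).toFinset.powerset, ∑ k ∈ Finset.range n,
      (if boxWeight t = m ∧ demFold (k.succPNat :: (t.sort (· ≤ ·)).map boxLetter) = w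
        then 1 else 0 : ℤ) =
    ∑ t ∈ (grid R n).toFinset.powerset, ∑ k ∈ Finset.range n,
      (if boxWeight t = m ∧ demFold ((t.sort (· ≤ ·)).map boxLetter ++ [k.succPNat]) = w
        then 1 else 0 : ℤ) := by
  have h := congrArg (fun z => demCoeff w (z.coeff m)) (commute_gridSum R n).eq
  simp only [gridSum, Finset.sum_mul_sum, AddMonoidAlgebra.single_mul_single, zero_add, add_zero,
    ← wordElt_cons] at h
  have h' : ∀ (a : List ℕ+) k, wordElt a * gen k = wordElt (a ++ [k]) := fun a k => by
    simp [wordElt]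
  simp only [h', AddMonoidAlgebra.coeff_sum, AddMonoidAlgebra.coeff_single, Finsupp.finsetSum_apply,
    Finsupp.single_apply, map_sum, apply_ite, map_zero, demCoeff_wordElt] at h
  rw [Finset.sum_comm] at h
  simpa only [ite_and] using h

/-! ### Coefficients of the two sums -/

theorem mem_grid (R : Finset ℤ) (n : ℕ) (p : ℤ × ℤ) :
    boxEmb p ∈ grid R n ↔ p.1 ∈ R ∧ 2 ≤ p.1 + p.2 ∧ p.1 + p.2 ≤ n + 1 := by
  simp only [grid, List.mem_flatMap, List.mem_map, List.mem_reverse, List.mem_range,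
    Finset.mem_sort, rowBox, boxEmb.injective.eq_iff]
  constructor
  · rintro ⟨i, hi, k, hk, rfl⟩
    exact ⟨hi, by simp only; omega, by simp only; omega⟩
  · rintro ⟨h1, h2, h3⟩
    exact ⟨p.1, h1, (p.1 + p.2 - 2).toNat, by omega, Prod.ext rfl (by simp only; omega)⟩

theorem coe_letter {p : ℤ × ℤ} (hp : 1 ≤ p.1 + p.2 - 1) : ((letter p : ℕ) : ℤ) = p.1 + p.2 - 1 := by
  unfold letter
  rw [Nat.toPNat'_coe, if_pos (by omega)]
  omega

theorem degree_boxWeight (t : Finset Box) : (boxWeight t).degree = t.card := by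
  simp [boxWeight]

theorem row_mem_support_boxWeight {t : Finset Box} {b : Box} (hb : b ∈ t) :
    (ofLex b).1 ∈ (boxWeight t).support := by
  rw [Finsupp.mem_support_iff, boxWeight, Finsupp.finsetSum_apply]
  refine (lt_of_lt_of_le (show 0 < (Finsupp.single (ofLex b).1 1 : ℤ →₀ ℕ) (ofLex b).1 by simp)
    (Finset.single_le_sum (f := fun c : Box => (Finsupp.single (ofLex c).1 1 : ℤ →₀ ℕ) (ofLex b).1)
      (fun _ _ => Nat.zero_le _) hb)).ne'

/-- The positive rows in which a pipe dream of weight `x^m` has positions. -/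
def posRows (m : ℤ →₀ ℕ) : Finset ℤ := m.support.filter (1 ≤ ·)

open Classical in
/-- All pipe dreams that contribute to the coefficient of `x^m` lie in a finite grid, once the letters
of the words with Demazure product `v` are bounded by `n`. -/
theorem coeff_kStanley (v : SInf) (n : ℕ) (hn : ∀ a, demFold a = v → ∀ k ∈ a, (k : ℕ) ≤ n)
    (m : ℤ →₀ ℕ) :
    MvPowerSeries.coeff m (kStanley v) = ∑ t ∈ (grid (posRows m) n).toFinset.powerset,
      if boxWeight t = m ∧ demFold ((t.sort (· ≤ ·)).map boxLetter) = v
        then Polynomial.X ^ (m.degree - len v) else 0 := by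
  have hinj : Function.Injective fun P : PD => P.1.map boxEmb := fun P Q h =>
    Subtype.ext (Finset.map_injective _ h)
  set S := (grid (posRows m) n).toFinset.powerset with hS
  set T : Finset PD := S.preimage (fun P : PD => P.1.map boxEmb) hinj.injOn with hT
  have hmT : ∀ P : PD, P ∈ T ↔ ∀ p ∈ P.1, boxEmb p ∈ grid (posRows m) n := fun P => by
    rw [hT, Finset.mem_preimage, hS, Finset.mem_powerset, Finset.map_subset_iff_subset_preimage]
    simp [Finset.subset_iff]
  have hcoeff : ∀ P : PD, MvPowerSeries.coeff m (P.wt v) =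
      if boxWeight (P.1.map boxEmb) = m then Polynomial.X ^ (m.degree - len v) else 0 := fun P => by
    rw [PD.coeff_wt, ← boxWeight_map]
    by_cases h : boxWeight (P.1.map boxEmb) = m
    · rw [if_pos h.symm, if_pos h, ← h, degree_boxWeight, Finset.card_map]
    · rw [if_neg (Ne.symm h), if_neg h]
  change ∑ᶠ P ∈ stablePD v, MvPowerSeries.coeff m (P.wt v) = _
  rw [finsum_mem_eq_sum_of_inter_support_eq (t := T.filter fun P => P.HasPerm v),
    Finset.sum_filter]
  · rw [← Finset.sum_preimage (fun P : PD => P.1.map boxEmb) S hinj.injOn]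
    · refine Finset.sum_congr rfl fun P _ => ?_
      rw [hcoeff, P.hasPerm_iff, P.word_eq]
      split_ifs <;> simp_all only [and_true, not_true_eq_false, and_false]
    · intro t ht hr
      -- Every subset of the grid comes from a pipe dream, as its letters are positive.
      refine absurd ?_ hr
      rw [hS, Finset.mem_powerset] at ht
      have hmap : (t.preimage boxEmb boxEmb.injective.injOn).map boxEmb = t := by
        rw [Finset.map_eq_image]
        exact Finset.image_preimage_of_bij _ _
          ⟨fun _ h => h, boxEmb.injective.injOn, fun b hb =>
            ⟨((ofLex b).1, OrderDual.ofDual (ofLex b).2), hb, rfl⟩⟩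
      refine ⟨⟨t.preimage boxEmb boxEmb.injective.injOn, fun p hp => ?_⟩, hmap⟩
      have := (mem_grid _ _ _).mp (List.mem_toFinset.mp (ht (Finset.mem_preimage.mp hp)))
      omega
  · ext P
    simp only [Set.mem_inter_iff, Finset.coe_filter, Set.mem_ofPred_eq, Function.mem_support,
      hcoeff, ite_ne_right_iff, stablePD, hmT]
    refine and_congr_left fun ⟨hm, _⟩ => ?_
    rw [and_comm, and_comm (b := P.HasPerm v)]
    refine and_congr_right fun hP => ⟨fun hst p hp => ?_, fun hg p hp => ?_⟩
    · rw [mem_grid]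
      have h1 := hn _ ((P.hasPerm_iff v).mp hP) _ (P.letter_mem_word hp)
      have h2 := coe_letter (P.2 p hp)
      have h3 := P.2 p hp
      have h4 : p.1 ∈ m.support := by
        rw [← hm]
        exact row_mem_support_boxWeight (Finset.mem_map_of_mem boxEmb hp)
      exact ⟨Finset.mem_filter.mpr ⟨h4, hst p hp⟩, by omega, by omega⟩
    · exact (Finset.mem_filter.mp ((mem_grid _ _ _).mp (hg p hp)).1).2

open Classical in
/-- Either sum of the theorem, coefficient by coefficient: as each factorization lowers the length
by at most one, all terms of the coefficient of `x^m` carry the same power of `β`, and the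
coefficient is this power times a number of pairs of a letter and a pipe dream. -/
theorem coeff_finsum_factors (w : SInf) (F : Set (ℕ+ × SInf)) (hF : F.Finite) (n : ℕ)
    (hn : ∀ k a, (k, demFold a) ∈ F → (k : ℕ) ≤ n ∧ ∀ l ∈ a, (l : ℕ) ≤ n)
    (hlen : ∀ q ∈ F, w = q.2 ∨ len w = len q.2 + 1) (m : ℤ →₀ ℕ) :
    MvPowerSeries.coeff m (∑ᶠ q ∈ F, betaDelta w q.2 * kStanley q.2) =
      Polynomial.X ^ (m.degree + 1 - len w) *
        ((∑ t ∈ (grid (posRows m) n).toFinset.powerset, ∑ k ∈ Finset.range n,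
          if boxWeight t = m ∧ (k.succPNat, demFold ((t.sort (· ≤ ·)).map boxLetter)) ∈ F
            then 1 else 0 : ℤ) : Polynomial ℤ) := by
  set S := (grid (posRows m) n).toFinset.powerset with hS
  have hbound : ∀ q ∈ F, ∀ a, demFold a = q.2 → ∀ l ∈ a, (l : ℕ) ≤ n := by
    rintro ⟨k, v⟩ hq a rfl
    exact (hn k a hq).2
  have hterm : ∀ q ∈ F, MvPowerSeries.coeff m (betaDelta w q.2 * kStanley q.2) =
      ∑ t ∈ S, if boxWeight t = m ∧ demFold ((t.sort (· ≤ ·)).map boxLetter) = q.2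
        then Polynomial.X ^ (m.degree + 1 - len w) else 0 := by
    intro q hq
    rw [betaDelta, MvPowerSeries.coeff_C_mul, coeff_kStanley q.2 n (hbound q hq), Finset.mul_sum]
    refine Finset.sum_congr rfl fun t _ => ?_
    rw [mul_ite, mul_zero]
    refine if_ctx_congr Iff.rfl (fun ⟨h1, h2⟩ => ?_) fun _ => rfl
    have hle : len q.2 ≤ m.degree := by
      have := len_demFold_le ((t.sort (· ≤ ·)).map boxLetter)
      rw [h2, List.length_map, Finset.length_sort] at this
      rwa [← h1, degree_boxWeight]
    -- `|P| - ℓ(v)` plus `δ_{w,v}` is `|P| + 1 - ℓ(w)`; by `hle` no subtraction truncates.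
    rw [← pow_add]
    congr 1
    rcases hlen q hq with h | h
    · rw [if_pos h, h]; omega
    · rw [if_neg fun h' => by rw [h'] at h; omega]; omega
  rw [finsum_mem_eq_finite_toFinset_sum _ hF, map_sum,
    Finset.sum_congr rfl fun q hq => hterm q (hF.mem_toFinset.mp hq), Finset.sum_comm,
    Int.cast_sum, Finset.mul_sum]
  refine Finset.sum_congr rfl fun t _ => ?_
  rw [Int.cast_sum, Finset.mul_sum]
  simp only [Int.cast_ite, Int.cast_one, Int.cast_zero, mul_ite, mul_one, mul_zero,
    ← Finset.sum_filter]
  refine Finset.sum_nbij' (fun q => (q.1 : ℕ) - 1)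
    (fun k => (k.succPNat, demFold ((t.sort (· ≤ ·)).map boxLetter))) ?_ ?_ ?_ ?_ fun _ _ => rfl
  · rintro ⟨k, v⟩ h
    obtain ⟨h1, h2, rfl⟩ := by simpa using h
    have h3 := (hn k _ h1).1
    have h4 := k.pos
    have h5 : ((k : ℕ) - 1).succPNat = k := PNat.succPNat_natPred k
    simp only [Finset.mem_filter, Finset.mem_range]
    exact ⟨by omega, h2, by rw [h5]; exact h1⟩
  · intro k h
    simp only [Finset.mem_filter, Finset.mem_range, Set.Finite.mem_toFinset] at h ⊢
    exact ⟨h.2.2, h.2.1, trivial⟩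
  · rintro ⟨k, v⟩ h
    obtain ⟨h1, h2, rfl⟩ := by simpa using h
    exact Prod.ext (PNat.succPNat_natPred k) rfl
  · intro k _
    simp

end PipeDream

theorem proposition7p7 (w : PipeDream.SInf) :
    ∑ᶠ q ∈ PipeDream.leftFactors w, PipeDream.betaDelta w q.2 * PipeDream.kStanley q.2 =
      ∑ᶠ q ∈ PipeDream.rightFactors w, PipeDream.betaDelta w q.2 * PipeDream.kStanley q.2 := by
  classical
  obtain ⟨N, hN⟩ := PipeDream.exists_letter_bound w
  have hN' : ∀ a, PipeDream.demFold a = w → ∀ l ∈ a, (l : ℕ) ≤ N := fun a ha l hl =>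
    PNat.coe_le_coe _ _ |>.mpr (hN a ha l hl).le
  ext1 m
  rw [PipeDream.coeff_finsum_factors w _ (PipeDream.finite_leftFactors w) N,
    PipeDream.coeff_finsum_factors w _ (PipeDream.finite_rightFactors w) N]
  · simp only [PipeDream.mem_leftFactors_iff, PipeDream.mem_rightFactors_iff]
    rw [PipeDream.sum_grid_cons_eq_append]
  · intro k a h
    have h1 := hN' _ ((PipeDream.mem_rightFactors_iff w k a).mp h)
    exact ⟨h1 k (by simp), fun l hl => h1 l (by simp [hl])⟩
  · rintro ⟨k, u⟩ h
    obtain ⟨a, rfl⟩ := PipeDream.exists_demFold_eq u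
    rw [← (PipeDream.mem_rightFactors_iff w k a).mp h]
    exact PipeDream.len_demFold_append_singleton a k
  · intro k a h
    have h1 := hN' _ ((PipeDream.mem_leftFactors_iff w k a).mp h)
    exact ⟨h1 k (by simp), fun l hl => h1 l (by simp [hl])⟩
  · rintro ⟨k, v⟩ h
    obtain ⟨a, rfl⟩ := PipeDream.exists_demFold_eq v
    rw [← (PipeDream.mem_leftFactors_iff w k a).mp h]
    exact PipeDream.len_demL k _
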